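/- Manifolds are smooth, Hausdorff, second countable, without boundary, of odd dimension $2n-1$ with $n\ge 2$. \textbf{Definitions.} An \emph{odd-dimensional symplectic form} on $M$ is a closed $2$-form whose kernel is a $1$-dimensional distribution. A \emph{virtually contact structure} is a tuple $(\pi\colon M'\to M,\alpha,\omega,g)$ consisting of an odd-dimensional symplectic form $\omega$ on $M$, a (smooth, surjective) covering $\pi$, a contact form $\alpha$ on $M'$ with $\pi^*\omega=\mathrm d\alpha$, and a Riemannian metric $g$ of bounded geometry on $M$ (the injectivity radius is positive and the absolute value of the sectional curvature is bounded) such that $\sup_{M'}|\alpha|_{(\pi^*g)^\flat}<\infty$ and such that, for some constant $c>0$, $|\alpha(v)|>c\,|v|_{\pi^*g}$ for all non-zero $v\in\ker\mathrm d\alpha$. It is \emph{somewhere contact} if there are a non-empty open set $U\subset M$ and a contact form $\alpha_U$ on $U$ with $\pi^*\alpha_U=\alpha$ on $\pi^{-1}(U)$. \textbf{Covering contact connected sum.} For $i=1,2$ let $(\pi_i\colon M_i'\to M_i,\alpha_i,\omega_i,g_i)$ be somewhere contact virtually contact structures. Choose open sets $U_i\subset M_i$ with contact forms $\alpha_{U_i}$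 satisfying $\pi_i^*\alpha_{U_i}=\alpha_i$ on $\pi_i^{-1}(U_i)$; closed embedded discs $D_i\subset U_i$ of dimension $2n-1$ having a neighbourhood with Darboux coordinates for $\alpha_{U_i}$; and base points $x_i\in\partial D_i$. Assume that $\pi_i^{-1}(U_i)$ is the disjoint union of open sheets $U_i^y\ni y$, $y\in\pi_i^{-1}(x_i)$, each mapped diffeomorphically onto $U_i$ by $\pi_i$. Choose a bijection $b\colon\pi_1^{-1}(x_1)\to\pi_2^{-1}(x_2)$. Let $$M=M_1\# M_2=(M_1\setminus \mathrm{Int}\,D_1)\cup\big([1,2]\times S^{2n-2}\big)\cup(M_2\setminus\mathrm{Int}\,D_2),$$ where $\{i\}\times S^{2n-2}$ is identified with $\partial D_i$. Let $\alpha_{U_1}\#\alpha_{U_2}$ be a contact form on $U_1\# U_2\subset M$ that coincides with $\alpha_{U_i}$ on $U_i\setminus D_i$ (for instance the one given by contact surgery of index $1$). Let $\omega$ be the $2$-form on $M$ that coincides with $\omega_i$ on $M_i\setminus U_i$ and with $\mathrm d(\alpha_{U_1}\#\alpha_{U_2})$ on $U_1\# U_2$, and let $g$ be a metric of bounded geometry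 on $M$ that extends $g_1$ and $g_2$ over the handle part $[1,2]\times S^{2n-2}$. Let $M'=M_1'\#_bM_2'$ be obtained from the sets $M_i'\setminus\pi_i^{-1}(\mathrm{Int}\,D_i)$ by gluing in, for each $y\in\pi_1^{-1}(x_1)$, one copy of $[1,2]\times S^{2n-2}$ that joins $U_1^y$ to $U_2^{b(y)}$; let $\pi\colon M'\to M$ be the map that restricts to $\pi_i$ on the two summands and to the identity on each handle; and let $\alpha$ be the $1$-form on $M'$ that restricts to $\alpha_i$ on $M_i'\setminus\pi_i^{-1}(U_i)$ and to $\pi^*(\alpha_{U_1}\#\alpha_{U_2})$ over $U_1\#U_2$. The tuple $(\pi\colon M'\to M,\alpha,\omega,g)$ is said to be obtained by covering contact connected sum. \textbf{Lemma.} For $i=1,2$ let $(\pi_i\colon M_i'\to M_i,\alpha_i,\omega_i,g_i)$ be a somewhere contact virtually contact structure. If $\omega_1$ is non-exact, then the odd-dimensional symplectic form $\omega$ on $M_1\# M_2$ belonging to any tuple $(\pi\colon M'\to M,\alpha,\omega,g)$ obtained from them by covering contact connected sum is non-exact. -/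

import Mathlib

open Set Metric
open scoped Manifold ContDiff Topology

noncomputable section

namespace VContact

/-- The Euclidean model space `ℝ^{2m+1}`. With `m = n - 1` this is `ℝ^{2n-1}`. -/
abbrev Model (m : ℕ) : Type := EuclideanSpace ℝ (Fin (2 * m + 1))

/-- The model with corners of manifolds without boundary of dimension `2m+1`. -/
abbrev modelI (m : ℕ) : ModelWithCorners ℝ (Model m) (Model m) := 𝓘(ℝ, Model m)

/-! ### Differential forms -/

/-- A (not necessarily smooth) differential `k`-form on `M`: a family of alternating `k`-linear
forms on the tangent spaces. -/
abbrev DiffForm (m k : ℕ) (M : Type*) [TopologicalSpace M] [ChartedSpace (Model m) M] :=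
  ∀ x : M, (TangentSpace (modelI m) x) [⋀^Fin k]→L[ℝ] ℝ

section Forms

variable {m k : ℕ}
  {M : Type*} [TopologicalSpace M] [ChartedSpace (Model m) M]
  {N : Type*} [TopologicalSpace N] [ChartedSpace (Model m) N]

/-- The pullback `f^* Ω`. -/
def pullback (f : M → N) (Ω : DiffForm m k N) : DiffForm m k M :=
  fun x => (Ω (f x)).compContinuousLinearMap (mfderiv (modelI m) (modelI m) f x)

/-- The expression of `Ω` in the preferred chart around `x₀`, that is, the pullback of `Ω` along
the inverse of that chart. It is meaningful on the target of the chart. -/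
def inChart (Ω : DiffForm m k M) (x₀ : M) : Model m → (Model m) [⋀^Fin k]→L[ℝ] ℝ :=
  fun u => (Ω ((extChartAt (modelI m) x₀).symm u)).compContinuousLinearMap
    (mfderiv (modelI m) (modelI m) (extChartAt (modelI m) x₀).symm u)

/-- Smoothness of `Ω` on the open set `U`: smoothness of its expression in all preferred charts. -/
def SmoothFormOn (Ω : DiffForm m k M) (U : Set M) : Prop :=
  ∀ x₀ : M, ContDiffOn ℝ ∞ (inChart Ω x₀)
    ((extChartAt (modelI m) x₀).target ∩ (extChartAt (modelI m) x₀).symm ⁻¹' U)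

/-- The exterior derivative: at `x` it is the exterior derivative of the expression of `Ω` in the
preferred chart at `x`, pulled back along that chart. -/
def extd (Ω : DiffForm m k M) : DiffForm m (k + 1) M :=
  fun x => (extDeriv (inChart Ω x) (extChartAt (modelI m) x x)).compContinuousLinearMap
    (mfderiv (modelI m) (modelI m) (extChartAt (modelI m) x) x)

/-- `Ω` is exact: it is the exterior derivative of a smooth form. -/
def IsExact (Ω : DiffForm m (k + 1) M) : Prop :=
  ∃ lam : DiffForm m k M, SmoothFormOn lam univ ∧ extd lam = Ω

/-- `Ω` is an odd-dimensional symplectic form: a smooth closed `2`-form whose kernel is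
one-dimensional at every point. -/
structure IsOddSymplectic (Ω : DiffForm m 2 M) : Prop where
  smooth : SmoothFormOn Ω univ
  closed : ∀ x, extd Ω x = 0
  ker_one_dim : ∀ x, ∃ r : TangentSpace (modelI m) x, r ≠ 0 ∧
    ∀ v : TangentSpace (modelI m) x, (∀ w, Ω x ![v, w] = 0) ↔ ∃ c : ℝ, v = c • r

/-- `α` is a contact form on the open set `U`: it is smooth and nowhere zero on `U`, and its
differential is nondegenerate on the hyperplanes `ker α`. For manifolds of dimension `2m+1` this
says that `α ∧ (dα)^m` vanishes nowhere on `U`. -/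
structure IsContactFormOn (α : DiffForm m 1 M) (U : Set M) : Prop where
  smooth : SmoothFormOn α U
  ne_zero : ∀ x ∈ U, α x ≠ 0
  nondegenerate : ∀ x ∈ U, ∀ v : TangentSpace (modelI m) x, α x ![v] = 0 →
    (∀ w : TangentSpace (modelI m) x, α x ![w] = 0 → extd α x ![v, w] = 0) → v = 0

/-- `f` restricts to a smooth embedding of the open set `s` onto an open set of `N`. -/
structure IsOpenEmbeddingOn (f : M → N) (s : Set M) : Prop where
  localDiffeo : IsLocalDiffeomorphOn (modelI m) (modelI m) ∞ f s
  injOn : InjOn f s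

end Forms

/-- The covector `dz + ∑ⱼ xⱼ dyⱼ` at the point `p` of `ℝ^{2m+1}` with coordinates
`(x₁, y₁, …, x_m, y_m, z)`. -/
def darbouxCovector (m : ℕ) (p : Model m) : Model m →L[ℝ] ℝ :=
  EuclideanSpace.proj (Fin.last (2 * m)) +
    ∑ j : Fin m, p ⟨2 * j.1, by omega⟩ •
      (EuclideanSpace.proj (⟨2 * j.1 + 1, by omega⟩ : Fin (2 * m + 1)) : Model m →L[ℝ] ℝ)

/-- The standard contact form `dz + ∑ⱼ xⱼ dyⱼ` on `ℝ^{2m+1}`. -/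
def darbouxForm (m : ℕ) : DiffForm m 1 (Model m) :=
  fun p => ContinuousAlternatingMap.ofSubsingleton ℝ (Model m) ℝ (0 : Fin 1) (darbouxCovector m p)

/-! ### Riemannian metrics of bounded geometry -/

/-- Smooth Riemannian metrics. -/
abbrev RMetric (m : ℕ) (M : Type*) [TopologicalSpace M] [ChartedSpace (Model m) M]
    [IsManifold (modelI m) ∞ M] :=
  Bundle.ContMDiffRiemannianMetric (modelI m) ∞ (Model m)
    (fun x : M => TangentSpace (modelI m) x)

section Curvature

variable {m : ℕ}

/-- The Christoffel symbols (second kind) at `u` of a metric `G` in coordinates, as the vector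
`Γ_u(v, w)`: it is determined by
`G(Γ(v, w), z) = (D_v G(w, z) + D_w G(v, z) - D_z G(v, w)) / 2` for all `z`. -/
def christoffel (G : Model m → Model m →L[ℝ] Model m →L[ℝ] ℝ) (u v w : Model m) : Model m :=
  (G u).inverse ((1 / 2 : ℝ) • (fderiv ℝ G u v w + fderiv ℝ G u w v
    - ((fderiv ℝ G u).flip v).flip w))

/-- The curvature tensor `R(v, w) z = ∇_v ∇_w z - ∇_w ∇_v z` at `u` of a metric in coordinates
(for constant coordinate fields `v`, `w`, `z`). -/
def curvature (G : Model m → Model m →L[ℝ] Model m →L[ℝ] ℝ) (u v w z : Model m) : Model m :=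
  fderiv ℝ (fun u' => christoffel G u' w z) u v - fderiv ℝ (fun u' => christoffel G u' v z) u w
    + christoffel G u v (christoffel G u w z) - christoffel G u w (christoffel G u v z)

variable {M : Type*} [TopologicalSpace M] [ChartedSpace (Model m) M] [IsManifold (modelI m) ∞ M]

/-- The length of a tangent vector. -/
def RMetric.length (g : RMetric m M) (x : M) (v : TangentSpace (modelI m) x) : ℝ :=
  Real.sqrt (g.inner x v v)

/-- The expression of a metric in the preferred chart around `x₀`. -/
def metricInChart (g : RMetric m M) (x₀ : M) : Model m → Model m →L[ℝ] Model m →L[ℝ] ℝ :=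
  fun u =>
    let A : Model m →L[ℝ] Model m :=
      mfderiv (modelI m) (modelI m) (extChartAt (modelI m) x₀).symm u
    let B : Model m →L[ℝ] Model m →L[ℝ] ℝ := g.inner ((extChartAt (modelI m) x₀).symm u)
    B.bilinearComp A A

/-- The sectional curvature of the plane spanned by `v` and `w` in the tangent space at `x`
(for linearly independent `v`, `w`), computed in the preferred chart at `x`; the tangent space at
`x` is identified with the model space by that chart. -/
def sectionalCurvature (g : RMetric m M) (x : M) (v w : Model m) : ℝ :=
  let G := metricInChart g x
  let u := extChartAt (modelI m) x x
  G u (curvature G u v w w) v / (G u v v * G u w w - G u v w ^ 2)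

/-- `c` is a geodesic on the open set `J` of times. -/
def IsGeodesicOn (g : RMetric m M) (c : ℝ → M) (J : Set ℝ) : Prop :=
  ContMDiffOn 𝓘(ℝ, ℝ) (modelI m) ∞ c J ∧
  ∀ t ∈ J,
    let q : ℝ → Model m := fun s => extChartAt (modelI m) (c t) (c s)
    deriv (deriv q) t
      + christoffel (metricInChart g (c t)) (q t) (deriv q t) (deriv q t) = 0

/-- The open ball of radius `r` in the tangent space at `p`. -/
def tangentBall (g : RMetric m M) (p : M) (r : ℝ) : Set (Model m) :=
  {v | g.length p v < r}

/-- The map `e` is the exponential map at `p` on the ball of radius `r`: for every tangent vector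
`v` at `p`, the curve `t ↦ e (t v)` is the geodesic through `p` with initial velocity `v`, as long
as `t v` stays in the ball. -/
def IsExpOn (g : RMetric m M) (p : M) (r : ℝ) (e : Model m → M) : Prop :=
  e 0 = p ∧ ∀ v : Model m,
    IsGeodesicOn g (fun t : ℝ => e (t • v)) {t : ℝ | t • v ∈ tangentBall g p r} ∧
    HasDerivAt (fun t : ℝ => extChartAt (modelI m) p (e (t • v))) v 0

/-- The injectivity radius at `p`: the supremum of the radii `r` such that the exponential map at
`p` is defined on the ball of radius `r` and is a diffeomorphism from it onto an open set. -/
def injRadiusAt (g : RMetric m M) (p : M) : ENNReal :=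
  ⨆ r ∈ {r : ℝ | 0 < r ∧ ∃ e : Model m → M, IsExpOn g p r e ∧
    IsOpenEmbeddingOn (m := m) e (tangentBall g p r)}, ENNReal.ofReal r

/-- The metric `g` has bounded geometry: its injectivity radius is positive and the absolute value
of its sectional curvature is bounded. -/
structure IsBoundedGeometry (g : RMetric m M) : Prop where
  injRadius_pos : 0 < ⨅ p : M, injRadiusAt g p
  sec_bounded : ∃ K : ℝ, ∀ (x : M) (v w : Model m), LinearIndependent ℝ ![v, w] →
    |sectionalCurvature g x v w| ≤ K

end Curvature

/-! ### Virtually contact structures -/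

section VirtuallyContact

variable {m : ℕ}
  {M' : Type*} [TopologicalSpace M'] [ChartedSpace (Model m) M']
  {M : Type*} [TopologicalSpace M] [ChartedSpace (Model m) M]

/-- The tuple `(π : M' → M, α, Ω, g)` is a virtually contact structure. -/
structure IsVirtuallyContact [IsManifold (modelI m) ∞ M] (π : M' → M) (α : DiffForm m 1 M')
    (Ω : DiffForm m 2 M) (g : RMetric m M) : Prop where
  /-- `(M, Ω)` is an odd-dimensional symplectic manifold. -/
  symplectic : IsOddSymplectic Ω
  /-- `π` is a smooth covering. -/
  covering : IsCoveringMap π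
  surjective : Function.Surjective π
  localDiffeo : IsLocalDiffeomorph (modelI m) (modelI m) ∞ π
  /-- `α` is a contact form on `M'` that is a primitive of the lift of `Ω`. -/
  contact : IsContactFormOn α univ
  primitive : pullback π Ω = extd α
  /-- `g` is of bounded geometry. -/
  boundedGeometry : IsBoundedGeometry g
  /-- The norm of `α` with respect to the dual of `π^* g` is bounded on `M'`. -/
  upper_bound : ∃ C : ℝ, ∀ (x : M') (v : TangentSpace (modelI m) x),
    |α x ![v]| ≤ C * g.length (π x) (mfderiv (modelI m) (modelI m) π x v)
  /-- `|α(v)| > c |v|` for all non-zero `v ∈ ker dα`. -/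
  lower_bound : ∃ c : ℝ, 0 < c ∧ ∀ (x : M') (v : TangentSpace (modelI m) x), v ≠ 0 →
    (∀ w, extd α x ![v, w] = 0) →
    c * g.length (π x) (mfderiv (modelI m) (modelI m) π x v) < |α x ![v]|

/-- The form `β` on the open set `U ⊆ M` is a contact form with `π^* β = α` on `π⁻¹(U)`
(the values of `β` outside `U` are irrelevant). -/
structure IsContactOver (π : M' → M) (α : DiffForm m 1 M') (U : Set M) (β : DiffForm m 1 M) :
    Prop where
  isOpen : IsOpen U
  contact : IsContactFormOn β U
  pullback_eq : ∀ x, π x ∈ U → pullback π β x = α x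

/-- The virtually contact structure with covering `π` and contact form `α` is somewhere contact. -/
def IsSomewhereContact (π : M' → M) (α : DiffForm m 1 M') : Prop :=
  ∃ (U : Set M) (β : DiffForm m 1 M), U.Nonempty ∧ IsContactOver π α U β

/-! ### The covering contact connected sum -/

/-- The choices made on one summand for a covering contact connected sum: an open set `U` that
carries a contact form `β` as in the definition of being somewhere contact and that is evenly
covered by `π`; a closed embedded disc `D = disc(closed unit ball)` in `U`, with a collar of width
`ε` in `U`, inside Darboux coordinates for `β`; and a base point on the boundary of `D`. -/
structure SurgerySite (π : M' → M) (α : DiffForm m 1 M') (ε : ℝ) where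
  U : Set M
  β : DiffForm m 1 M
  contactOver : IsContactOver π α U β
  disc : Model m → M
  disc_embedding : IsOpenEmbeddingOn (m := m) disc (ball 0 (1 + ε))
  disc_subset : disc '' ball 0 (1 + ε) ⊆ U
  /-- A neighbourhood `V` of the disc has Darboux coordinates. -/
  darboux : ∃ (V : Set M) (κ : M → Model m), IsOpen V ∧ V ⊆ U ∧ disc '' closedBall 0 1 ⊆ V ∧
    IsOpenEmbeddingOn (m := m) κ V ∧ ∀ x ∈ V, pullback κ (darbouxForm m) x = β x
  base : M
  base_mem : base ∈ disc '' sphere 0 1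
  /-- The sheets `U^y` over `U`, indexed by the points `y` of the fibre over the base point. -/
  sheet : (π ⁻¹' {base} : Set M') → Set M'
  sheet_open : ∀ y, IsOpen (sheet y)
  mem_sheet : ∀ y, y.1 ∈ sheet y
  sheet_disjoint : Pairwise (fun y z => Disjoint (sheet y) (sheet z))
  iUnion_sheet : ⋃ y, sheet y = π ⁻¹' U
  sheet_bijOn : ∀ y, BijOn π (sheet y) U

/-- The closed disc that is removed. -/
def SurgerySite.D {π : M' → M} {α : DiffForm m 1 M'} {ε : ℝ} (S : SurgerySite π α ε) : Set M :=
  S.disc '' closedBall 0 1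

end VirtuallyContact

/-- The part `[1,2] × S^{2m}` of the boundary of the `1`-handle `[1,2] × D^{2m+1}`, realised in
polar coordinates `(t, θ) ↦ t θ` as a closed annulus of `ℝ^{2m+1}`. -/
def handleAnnulus (m : ℕ) : Set (Model m) := {u | 1 ≤ ‖u‖ ∧ ‖u‖ ≤ 2}

/-- The handle together with collars of width `ε` at both ends. -/
def collaredAnnulus (m : ℕ) (ε : ℝ) : Set (Model m) := {u | 1 - ε < ‖u‖ ∧ ‖u‖ < 2 + ε}

section ConnectedSum

variable {m : ℕ}
  {M₁' : Type*} [TopologicalSpace M₁'] [ChartedSpace (Model m) M₁']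
  {M₁ : Type*} [TopologicalSpace M₁] [ChartedSpace (Model m) M₁] [IsManifold (modelI m) ∞ M₁]
  {M₂' : Type*} [TopologicalSpace M₂'] [ChartedSpace (Model m) M₂']
  {M₂ : Type*} [TopologicalSpace M₂] [ChartedSpace (Model m) M₂] [IsManifold (modelI m) ∞ M₂]
  {M' : Type*} [TopologicalSpace M'] [ChartedSpace (Model m) M']
  {M : Type*} [TopologicalSpace M] [ChartedSpace (Model m) M] [IsManifold (modelI m) ∞ M]

/-- A presentation of the tuple `(π : M' → M, α, Ω, g)` as a covering contact connected sum of
`(π₁ : M₁' → M₁, α₁, Ω₁, g₁)` and `(π₂ : M₂' → M₂, α₂, Ω₂, g₂)`.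

The manifold `M = M₁ # M₂` is the union of `M₁ \ D₁`, `M₂ \ D₂` and the handle part
`[1,2] × S^{2m}`, glued along the boundary spheres of the discs; `M' = M₁' #_b M₂'` is the
corresponding union upstairs, with one handle for every point `y` of the fibre of `π₁` over the
base point, which joins the sheet of `y` to the sheet of `b y`. The contact form on the handle
may be any one that makes `γ` a contact form on `U₁ # U₂` extending those on `Uᵢ \ Dᵢ`, as the
form provided by contact surgery of index one does. Neither that `π` is a covering nor that
`(π, α, Ω, g)` is again a virtually contact structure is required here. -/
structure CoveringContactConnectedSum
    (π₁ : M₁' → M₁) (α₁ : DiffForm m 1 M₁') (Ω₁ : DiffForm m 2 M₁) (g₁ : RMetric m M₁)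
    (π₂ : M₂' → M₂) (α₂ : DiffForm m 1 M₂') (Ω₂ : DiffForm m 2 M₂) (g₂ : RMetric m M₂)
    (π : M' → M) (α : DiffForm m 1 M') (Ω : DiffForm m 2 M) (g : RMetric m M) where
  /-- The width of the collars. -/
  ε : ℝ
  ε_pos : 0 < ε
  ε_lt : ε < 1
  site₁ : SurgerySite π₁ α₁ ε
  site₂ : SurgerySite π₂ α₂ ε
  /-- The bijection between the fibres over the base points. -/
  b : (π₁ ⁻¹' {site₁.base} : Set M₁') ≃ (π₂ ⁻¹' {site₂.base} : Set M₂')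
  /-- The inclusion of `M₁ \ D₁` into the connected sum. -/
  ι₁ : M₁ → M
  ι₁_embedding : IsOpenEmbeddingOn (m := m) ι₁ site₁.Dᶜ
  /-- The inclusion of `M₂ \ D₂` into the connected sum. -/
  ι₂ : M₂ → M
  ι₂_embedding : IsOpenEmbeddingOn (m := m) ι₂ site₂.Dᶜ
  /-- The inclusion of the handle part, with collars. -/
  handle : Model m → M
  handle_embedding : IsOpenEmbeddingOn (m := m) handle (collaredAnnulus m ε)
  glue₁ : ∀ θ : Model m, ‖θ‖ = 1 → ∀ s ∈ Ioo 0 ε,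
    handle ((1 - s) • θ) = ι₁ (site₁.disc ((1 + s) • θ))
  glue₂ : ∀ θ : Model m, ‖θ‖ = 1 → ∀ s ∈ Ioo 0 ε,
    handle ((2 + s) • θ) = ι₂ (site₂.disc ((1 + s) • θ))
  cover : ι₁ '' site₁.Dᶜ ∪ handle '' handleAnnulus m ∪ ι₂ '' site₂.Dᶜ = univ
  disjoint₁ : Disjoint (ι₁ '' site₁.Dᶜ) (handle '' handleAnnulus m)
  disjoint₂ : Disjoint (ι₂ '' site₂.Dᶜ) (handle '' handleAnnulus m)
  disjoint₁₂ : Disjoint (ι₁ '' site₁.Dᶜ) (ι₂ '' site₂.Dᶜ)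
  /-- The open subset `U₁ # U₂` of `M₁ # M₂`. -/
  UU : Set M
  UU_eq : UU = ι₁ '' (site₁.U \ site₁.D) ∪ handle '' handleAnnulus m ∪
    ι₂ '' (site₂.U \ site₂.D)
  /-- The contact form on `U₁ # U₂`, which coincides with the given ones on `Uᵢ \ Dᵢ`. -/
  γ : DiffForm m 1 M
  γ_contact : IsContactFormOn γ UU
  γ_eq₁ : ∀ x ∈ site₁.U \ site₁.D, pullback ι₁ γ x = site₁.β x
  γ_eq₂ : ∀ x ∈ site₂.U \ site₂.D, pullback ι₂ γ x = site₂.β x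
  /-- The form `Ω` coincides with `Ωᵢ` on `Mᵢ \ Uᵢ` and with `dγ` on `U₁ # U₂`. -/
  Ω_eq₁ : ∀ x ∈ site₁.Uᶜ, pullback ι₁ Ω x = Ω₁ x
  Ω_eq₂ : ∀ x ∈ site₂.Uᶜ, pullback ι₂ Ω x = Ω₂ x
  Ω_eq : ∀ x ∈ UU, Ω x = extd γ x
  /-- The metric `g` is of bounded geometry and extends `g₁` and `g₂` over the handle. -/
  g_bounded : IsBoundedGeometry g
  g_eq₁ : ∀ x ∈ site₁.Dᶜ, ∀ v w : TangentSpace (modelI m) x,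
    g.inner (ι₁ x) (mfderiv (modelI m) (modelI m) ι₁ x v) (mfderiv (modelI m) (modelI m) ι₁ x w)
      = g₁.inner x v w
  g_eq₂ : ∀ x ∈ site₂.Dᶜ, ∀ v w : TangentSpace (modelI m) x,
    g.inner (ι₂ x) (mfderiv (modelI m) (modelI m) ι₂ x v) (mfderiv (modelI m) (modelI m) ι₂ x w)
      = g₂.inner x v w
  /-- The inclusion of `M₁' \ π₁⁻¹(D₁)` into the total space. -/
  ι₁' : M₁' → M'
  ι₁'_embedding : IsOpenEmbeddingOn (m := m) ι₁' (π₁ ⁻¹' site₁.D)ᶜ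
  /-- The inclusion of `M₂' \ π₂⁻¹(D₂)` into the total space. -/
  ι₂' : M₂' → M'
  ι₂'_embedding : IsOpenEmbeddingOn (m := m) ι₂' (π₂ ⁻¹' site₂.D)ᶜ
  /-- The inclusions of the handle parts, with collars. -/
  handle' : (π₁ ⁻¹' {site₁.base} : Set M₁') → Model m → M'
  handle'_embedding : ∀ y, IsOpenEmbeddingOn (m := m) (handle' y) (collaredAnnulus m ε)
  glue₁' : ∀ y, ∀ θ : Model m, ‖θ‖ = 1 → ∀ s ∈ Ioo 0 ε, ∀ z ∈ site₁.sheet y,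
    π₁ z = site₁.disc ((1 + s) • θ) → handle' y ((1 - s) • θ) = ι₁' z
  glue₂' : ∀ y, ∀ θ : Model m, ‖θ‖ = 1 → ∀ s ∈ Ioo 0 ε, ∀ z ∈ site₂.sheet (b y),
    π₂ z = site₂.disc ((1 + s) • θ) → handle' y ((2 + s) • θ) = ι₂' z
  cover' : ι₁' '' (π₁ ⁻¹' site₁.D)ᶜ ∪ (⋃ y, handle' y '' handleAnnulus m) ∪
    ι₂' '' (π₂ ⁻¹' site₂.D)ᶜ = univ
  disjoint₁' : ∀ y, Disjoint (ι₁' '' (π₁ ⁻¹' site₁.D)ᶜ) (handle' y '' handleAnnulus m)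
  disjoint₂' : ∀ y, Disjoint (ι₂' '' (π₂ ⁻¹' site₂.D)ᶜ) (handle' y '' handleAnnulus m)
  disjoint₁₂' : Disjoint (ι₁' '' (π₁ ⁻¹' site₁.D)ᶜ) (ι₂' '' (π₂ ⁻¹' site₂.D)ᶜ)
  disjoint_handles : Pairwise (fun y z =>
    Disjoint (handle' y '' handleAnnulus m) (handle' z '' handleAnnulus m))
  /-- The map `π` restricts to `πᵢ` on the summands and is the identity on each handle. -/
  π_ι₁' : ∀ x ∈ (π₁ ⁻¹' site₁.D)ᶜ, π (ι₁' x) = ι₁ (π₁ x)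
  π_ι₂' : ∀ x ∈ (π₂ ⁻¹' site₂.D)ᶜ, π (ι₂' x) = ι₂ (π₂ x)
  π_handle' : ∀ y, ∀ u ∈ collaredAnnulus m ε, π (handle' y u) = handle u
  /-- The form `α` restricts to `αᵢ` over `Mᵢ \ Uᵢ` and to `π^* γ` over `U₁ # U₂`. -/
  α_eq₁ : ∀ x ∈ (π₁ ⁻¹' site₁.U)ᶜ, pullback ι₁' α x = α₁ x
  α_eq₂ : ∀ x ∈ (π₂ ⁻¹' site₂.U)ᶜ, pullback ι₂' α x = α₂ x
  α_eq : ∀ x ∈ π ⁻¹' UU, α x = pullback π γ x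

end ConnectedSum

end VContact

end

open VContact

/-! The contrapositive is a Mayer–Vietoris argument. A primitive `lam` of `Ω` on the connected sum
pulls back along `ι₁` to a primitive `μ` of `Ω₁` on `M₁ \ D₁`: away from `U₁` the two forms agree by
construction, and on `U₁ \ D₁` both are the differential of the contact form `β`. Near the disc `β`
itself is a primitive of `Ω₁` (`IsContactOver.extd_eq`). So `μ - β` is a closed one-form on a
spherical shell around `D₁`.

The shell is diffeomorphic to `ℝ^{2m+1} \ {0}`, and `2m+1 ≥ 3`, so every closed one-form on it is
exact (`exists_primitive_shell`): `μ - β = df`. With a cutoff `χ` equal to 1 near the disc, `β +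
d((1 - χ) f)` is a primitive of `Ω₁` on the larger ball that agrees with `μ` near its boundary
(`exists_merged_primitive`). It extends by `μ` to all of `M₁` (`SurgerySite.isExact`).

Exactness on the punctured space comes from the Poincaré lemma on half-spaces. Those containing `e`
fill the complement of the ray opposite to `e`. Two such slit spaces, for `e` and `-e`, cover the
punctured space and meet in the complement of a line, which is connected. -/

namespace VContact

/-! ### Closed one-forms on the punctured space -/

section Primitives

variable {E : Type*} [NormedAddCommGroup E]

/-- Primitives of a one-form on open sets that share a point and have preconnected pairwise
intersections glue. -/
theorem exists_primitive_iUnion [NormedSpace ℝ E] {ι : Type*} {w : E → E →L[ℝ] ℝ} {C : ι → Set E}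
    {p : E} (hC : ∀ i, IsOpen (C i)) (hp : ∀ i, p ∈ C i)
    (hconn : ∀ i j, i ≠ j → IsPreconnected (C i ∩ C j))
    (hprim : ∀ i, ∃ f : E → ℝ, ∀ x ∈ C i, HasFDerivAt f (w x) x) :
    ∃ f : E → ℝ, ∀ x ∈ ⋃ i, C i, HasFDerivAt f (w x) x := by
  classical
  choose f hf using hprim
  -- Normalising all primitives to vanish at the common point `p` removes the additive constants, so
  -- they agree on connected overlaps.
  let g : ι → E → ℝ := fun i x => f i x - f i p
  have hg : ∀ i, ∀ x ∈ C i, HasFDerivAt (g i) (w x) x := fun i x hx => (hf i x hx).sub_const _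
  have heq : ∀ i j, ∀ x ∈ C i ∩ C j, g i x = g j x := by
    intro i j x hx
    rcases eq_or_ne i j with rfl | hij
    · rfl
    · refine IsOpen.eqOn_of_fderiv_eq (𝕜 := ℝ) ((hC i).inter (hC j)) (hconn i j hij)
        (fun y hy => (hg i y hy.1).differentiableAt.differentiableWithinAt)
        (fun y hy => (hg j y hy.2).differentiableAt.differentiableWithinAt)
        (fun y hy => by rw [(hg i y hy.1).fderiv, (hg j y hy.2).fderiv]) ⟨hp i, hp j⟩ ?_ hx
      simp [g]
  refine ⟨fun x => if h : ∃ i, x ∈ C i then g h.choose x else 0, fun x hx => ?_⟩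
  obtain ⟨i, hi⟩ := mem_iUnion.1 hx
  refine (hg i x hi).congr_of_eventuallyEq ?_
  filter_upwards [(hC i).mem_nhds hi] with y hy
  have h : ∃ i, y ∈ C i := ⟨i, hy⟩
  rw [dif_pos h]
  exact heq _ _ _ ⟨h.choose_spec, hy⟩

variable [InnerProductSpace ℝ E]

/-- The union of the open half-spaces `{x | 0 < ⟪v, x⟫}` that contain `e`. -/
def halfSpaceStar (e : E) : Set E :=
  ⋃ v : {v : E // 0 < inner ℝ v e}, {x | 0 < inner ℝ v.1 x}

theorem isOpen_halfSpace (v : E) : IsOpen {x : E | 0 < inner ℝ v x} :=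
  isOpen_lt continuous_const (by fun_prop)

theorem convex_halfSpace (v : E) : Convex ℝ {x : E | 0 < inner ℝ v x} := by
  simpa using convex_halfSpace_gt (𝕜 := ℝ) (f := fun x : E => inner ℝ v x)
    ⟨fun x y => inner_add_right _ _ _, fun c x => by simp [inner_smul_right]⟩ 0

theorem isOpen_halfSpaceStar (e : E) : IsOpen (halfSpaceStar e) :=
  isOpen_iUnion fun v => isOpen_halfSpace v.1

/-- None of the half-spaces contains the origin, and they and their pairwise intersections are
convex. So the Poincaré lemma applies on each, and the primitives glue, with `e` as the common
point. -/
theorem exists_primitive_halfSpaceStar {w : E → E →L[ℝ] ℝ} {e : E}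
    (hw : ∀ x : E, x ≠ 0 → DifferentiableAt ℝ w x)
    (hsymm : ∀ x : E, x ≠ 0 → ∀ u v, fderiv ℝ w x u v = fderiv ℝ w x v u) :
    ∃ f : E → ℝ, ∀ x ∈ halfSpaceStar e, HasFDerivAt f (w x) x := by
  have hne : ∀ v x : E, 0 < inner ℝ v x → x ≠ 0 := by
    rintro v x h rfl
    simp at h
  refine exists_primitive_iUnion (p := e) (fun v => isOpen_halfSpace v.1) (fun v => v.2)
    (fun v v' _ => ((convex_halfSpace v.1).inter (convex_halfSpace v'.1)).isPreconnected)
    fun v => ?_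
  exact (convex_halfSpace v.1).exists_forall_hasFDerivAt_of_fderiv_symmetric
    (isOpen_halfSpace v.1) (fun x hx => (hw x (hne _ _ hx)).differentiableWithinAt)
    fun x hx => hsymm x (hne _ _ hx)

/-- The bisector `‖e‖ • x + ‖x‖ • e` has inner products with `x` and `e` that are positive multiples
of `⟪x, e⟫ + ‖x‖ ‖e‖`. By the equality case of Cauchy–Schwarz, this vanishes only if `x` is on the
line of `e`. -/
theorem mem_halfSpaceStar_of_notMem_span {e x : E} (he : e ≠ 0)
    (hx : x ∉ Submodule.span ℝ {e}) : x ∈ halfSpaceStar e := by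
  have hx0 : x ≠ 0 := by
    rintro rfl
    exact hx (Submodule.zero_mem _)
  have hpos : 0 < inner ℝ x e + ‖x‖ * ‖e‖ := by
    have h1 := neg_le_of_abs_le (abs_real_inner_le_norm x e)
    refine lt_of_le_of_ne (by linarith) fun h => hx ?_
    have h2 : |inner ℝ e x / (‖e‖ * ‖x‖)| = 1 := by
      have h3 : inner ℝ e x = -(‖e‖ * ‖x‖) := by rw [real_inner_comm]; linarith
      rw [h3, neg_div, abs_neg, div_self (by positivity), abs_one]
    obtain ⟨-, r, -, hr⟩ := (abs_real_inner_div_norm_mul_norm_eq_one_iff e x).1 h2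
    exact Submodule.mem_span_singleton.2 ⟨r, hr.symm⟩
  have hxn : 0 < ‖x‖ := norm_pos_iff.2 hx0
  have hen : 0 < ‖e‖ := norm_pos_iff.2 he
  refine mem_iUnion.2 ⟨⟨‖e‖ • x + ‖x‖ • e, ?_⟩, ?_⟩
  · rw [inner_add_left, real_inner_smul_left, real_inner_smul_left, real_inner_self_eq_norm_sq]
    nlinarith [mul_pos hen hpos]
  · change 0 < inner ℝ (‖e‖ • x + ‖x‖ • e) x
    rw [inner_add_left, real_inner_smul_left, real_inner_smul_left, real_inner_self_eq_norm_sq,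
      real_inner_comm]
    nlinarith [mul_pos hxn hpos]

theorem smul_mem_halfSpaceStar_iff {e : E} (he : e ≠ 0) (c : ℝ) :
    c • e ∈ halfSpaceStar e ↔ 0 < c := by
  constructor
  · intro h
    obtain ⟨v, hv⟩ := mem_iUnion.1 h
    have hv' : 0 < inner ℝ v.1 (c • e) := hv
    rw [inner_smul_right] at hv'
    exact pos_of_mul_pos_left hv' v.2.le
  · intro h
    refine mem_iUnion.2 ⟨⟨e, real_inner_self_pos.2 he⟩, ?_⟩
    change 0 < inner ℝ e (c • e)
    rw [inner_smul_right]
    exact mul_pos h (real_inner_self_pos.2 he)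

theorem halfSpaceStar_inter_neg {e : E} (he : e ≠ 0) :
    halfSpaceStar e ∩ halfSpaceStar (-e) = (Submodule.span ℝ {e} : Set E)ᶜ := by
  ext x
  constructor
  · rintro ⟨h1, h2⟩ hx
    obtain ⟨c, rfl⟩ := Submodule.mem_span_singleton.1 hx
    rw [← neg_smul_neg, smul_mem_halfSpaceStar_iff (neg_ne_zero.2 he)] at h2
    rw [smul_mem_halfSpaceStar_iff he] at h1
    linarith
  · intro hx
    refine ⟨mem_halfSpaceStar_of_notMem_span he hx,
      mem_halfSpaceStar_of_notMem_span (neg_ne_zero.2 he) ?_⟩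
    rwa [← Set.neg_singleton, Submodule.span_neg]

theorem compl_zero_subset_halfSpaceStar_union {e : E} (he : e ≠ 0) {x : E} (hx : x ≠ 0) :
    x ∈ halfSpaceStar e ∪ halfSpaceStar (-e) := by
  by_cases h : x ∈ Submodule.span ℝ {e}
  · obtain ⟨c, rfl⟩ := Submodule.mem_span_singleton.1 h
    rcases lt_trichotomy c 0 with hc | rfl | hc
    · right
      rw [← neg_smul_neg, smul_mem_halfSpaceStar_iff (neg_ne_zero.2 he)]
      linarith
    · simp at hx
    · left
      exact (smul_mem_halfSpaceStar_iff he c).2 hc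
  · exact Or.inl (mem_halfSpaceStar_of_notMem_span he h)

/-- A closed one-form on the complement of the origin is exact in dimension at least three. -/
theorem exists_primitive_compl_zero [FiniteDimensional ℝ E] (hdim : 2 < Module.finrank ℝ E)
    {w : E → E →L[ℝ] ℝ} (hw : ∀ x : E, x ≠ 0 → DifferentiableAt ℝ w x)
    (hsymm : ∀ x : E, x ≠ 0 → ∀ u v, fderiv ℝ w x u v = fderiv ℝ w x v u) :
    ∃ f : E → ℝ, ∀ x : E, x ≠ 0 → HasFDerivAt f (w x) x := by
  have : Nontrivial E := Module.nontrivial_of_finrank_pos (R := ℝ) (by omega)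
  obtain ⟨e, he⟩ := exists_ne (0 : E)
  -- Dimension at least three enters here: a line then has codimension at least two, so its
  -- complement is connected.
  have hcodim : 1 < Module.rank ℝ (E ⧸ Submodule.span ℝ {e}) := by
    have h1 := Submodule.finrank_quotient_add_finrank (Submodule.span ℝ {e})
    rw [finrank_span_singleton he] at h1
    rw [← Module.finrank_eq_rank]
    exact_mod_cast (by omega : 1 < Module.finrank ℝ (E ⧸ Submodule.span ℝ {e}))
  have hconn := isConnected_compl_of_one_lt_codim hcodim
  rw [← halfSpaceStar_inter_neg he] at hconn
  obtain ⟨p, hp1, hp2⟩ := hconn.nonempty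
  obtain ⟨f, hf⟩ := exists_primitive_iUnion (w := w) (p := p)
    (C := fun b : Bool => cond b (halfSpaceStar e) (halfSpaceStar (-e)))
    (by rintro (_ | _) <;> exact isOpen_halfSpaceStar _)
    (by rintro (_ | _) <;> assumption)
    (by
      rintro (_ | _) (_ | _) h
      · exact (h rfl).elim
      · rw [inter_comm]; exact hconn.isPreconnected
      · exact hconn.isPreconnected
      · exact (h rfl).elim)
    (by rintro (_ | _) <;> exact exists_primitive_halfSpaceStar hw hsymm)
  refine ⟨f, fun x hx => hf x ?_⟩
  rcases compl_zero_subset_halfSpaceStar_union he hx with h | h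
  · exact mem_iUnion.2 ⟨true, h⟩
  · exact mem_iUnion.2 ⟨false, h⟩

end Primitives

theorem minSmoothness_two_le_infty : minSmoothness ℝ 2 ≤ ∞ := by
  rw [minSmoothness_of_isRCLikeNormedField]
  exact WithTop.coe_le_coe.2 (le_top : (2 : ℕ∞) ≤ ⊤)

/-! ### One-forms as covector fields -/

section OneForms

variable {E : Type*} [NormedAddCommGroup E] [NormedSpace ℝ E]

/-- One-forms as alternating maps and as covectors. -/
noncomputable abbrev oneFormEquiv (E : Type*) [NormedAddCommGroup E] [NormedSpace ℝ E] :
    (E →L[ℝ] ℝ) ≃ₗᵢ[ℝ] (E [⋀^Fin 1]→L[ℝ] ℝ) :=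
  ContinuousAlternatingMap.ofSubsingletonLIE 0

theorem oneFormEquiv_apply (l : E →L[ℝ] ℝ) (v : Fin 1 → E) : oneFormEquiv E l v = l (v 0) := rfl

theorem oneFormEquiv_symm_apply (A : E [⋀^Fin 1]→L[ℝ] ℝ) (v : E) :
    (oneFormEquiv E).symm A v = A ![v] := by
  obtain ⟨l, rfl⟩ := (oneFormEquiv E).surjective A
  rw [LinearIsometryEquiv.symm_apply_apply, oneFormEquiv_apply]
  rfl

/-- By `dτ(u, v) = D_u τ(v) - D_v τ(u)`, closedness is symmetry of the derivative, the form in which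
the Poincaré lemma on convex sets is applied. -/
theorem fderiv_symm_of_extDeriv_eq_zero {τ : E → E [⋀^Fin 1]→L[ℝ] ℝ} {x : E}
    (hτ : DifferentiableAt ℝ τ x) (h : extDeriv τ x = 0) (u v : E) :
    fderiv ℝ (fun y => (oneFormEquiv E).symm (τ y)) x u v =
      fderiv ℝ (fun y => (oneFormEquiv E).symm (τ y)) x v u := by
  have hd : DifferentiableAt ℝ (fun y => (oneFormEquiv E).symm (τ y)) x :=
    (oneFormEquiv E).symm.differentiable.differentiableAt.comp x hτ
  have key : ∀ a b : E, fderiv ℝ (fun y => τ y ![b]) x a =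
      fderiv ℝ (fun y => (oneFormEquiv E).symm (τ y)) x a b := by
    intro a b
    have : (fun y => τ y ![b]) = fun y => (oneFormEquiv E).symm (τ y) b := by
      funext y
      rw [oneFormEquiv_symm_apply]
    rw [this, fderiv_clm_apply hd (by fun_prop)]
    simp
  have h2 : extDeriv τ x ![u, v] = 0 := by rw [h]; rfl
  rw [extDeriv_apply hτ, Fin.sum_univ_two] at h2
  have e0 : (0 : Fin 2).removeNth ![u, v] = ![v] := by
    ext i; fin_cases i; rfl
  have e1 : (1 : Fin 2).removeNth ![u, v] = ![u] := by
    ext i; fin_cases i; rfl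
  rw [e0, e1, key] at h2
  simp only [Matrix.cons_val_one, Matrix.cons_val_zero, key] at h2
  simp only [Fin.val_zero, pow_zero, one_smul, Fin.val_one, pow_one, neg_smul] at h2
  linarith

theorem oneFormEquiv_symm_compContinuousLinearMap {F : Type*} [NormedAddCommGroup F]
    [NormedSpace ℝ F] (A : F [⋀^Fin 1]→L[ℝ] ℝ) (T : E →L[ℝ] F) :
    (oneFormEquiv E).symm (A.compContinuousLinearMap T) = ((oneFormEquiv F).symm A).comp T := by
  ext v
  rw [oneFormEquiv_symm_apply, ContinuousLinearMap.comp_apply, oneFormEquiv_symm_apply,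
    ContinuousAlternatingMap.compContinuousLinearMap_apply]
  congr 1
  ext i; fin_cases i; rfl

theorem contDiffAt_compContinuousLinearMap {F G : Type*} [NormedAddCommGroup F]
    [NormedSpace ℝ F] [NormedAddCommGroup G] [NormedSpace ℝ G] {n : WithTop ℕ∞}
    {A : G → F [⋀^Fin 1]→L[ℝ] ℝ} {T : G → E →L[ℝ] F} {x : G}
    (hA : ContDiffAt ℝ n A x) (hT : ContDiffAt ℝ n T x) :
    ContDiffAt ℝ n (fun y => (A y).compContinuousLinearMap (T y)) x := by
  have h : (fun y => (A y).compContinuousLinearMap (T y)) =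
      fun y => oneFormEquiv E (((oneFormEquiv F).symm (A y)).comp (T y)) := by
    funext y
    rw [← oneFormEquiv_symm_compContinuousLinearMap, LinearIsometryEquiv.apply_symm_apply]
  rw [h]
  exact (oneFormEquiv E).contDiff.contDiffAt.comp x
    (((oneFormEquiv F).symm.contDiff.contDiffAt.comp x hA).clm_comp hT)

end OneForms

/-! ### Closed one-forms on a spherical shell -/

section Shell

variable {E : Type*} [NormedAddCommGroup E]

/-- The open shell `{y | 1 < ‖y‖ < 1 + ε}`. -/
def shell (E : Type*) [NormedAddCommGroup E] (ε : ℝ) : Set E := {y | 1 < ‖y‖ ∧ ‖y‖ < 1 + ε}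

theorem isOpen_shell (ε : ℝ) : IsOpen (shell E ε) :=
  (isOpen_lt continuous_const continuous_norm).inter (isOpen_lt continuous_norm continuous_const)

variable [InnerProductSpace ℝ E]

/-- A diffeomorphism from the complement of the origin onto the shell. -/
noncomputable def toShell (ε : ℝ) (x : E) : E := (1 / ‖x‖ + ε / (1 + ‖x‖)) • x

/-- The inverse of `toShell`. -/
noncomputable def ofShell (ε : ℝ) (y : E) : E := ((‖y‖ - 1) / ((1 + ε - ‖y‖) * ‖y‖)) • y

/-- In polar coordinates `toShell` is `r ↦ 1 + ε r / (1 + r)`, which maps `(0, ∞)` onto `(1, 1 +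
ε)`; solving for `r` gives the factor in `ofShell`. -/
theorem norm_toShell {ε : ℝ} (hε : 0 < ε) {x : E} (hx : x ≠ 0) :
    ‖toShell ε x‖ = 1 + ε * ‖x‖ / (1 + ‖x‖) := by
  have h : 0 < ‖x‖ := norm_pos_iff.2 hx
  rw [toShell, norm_smul, Real.norm_of_nonneg (by positivity)]
  field_simp

theorem toShell_mem {ε : ℝ} (hε : 0 < ε) {x : E} (hx : x ≠ 0) : toShell ε x ∈ shell E ε := by
  have h : 0 < ‖x‖ := norm_pos_iff.2 hx
  have h2 : ε * ‖x‖ / (1 + ‖x‖) < ε := by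
    rw [div_lt_iff₀ (by positivity)]
    nlinarith
  have h3 : 0 < ε * ‖x‖ / (1 + ‖x‖) := by positivity
  refine ⟨?_, ?_⟩ <;> rw [norm_toShell hε hx] <;> linarith

theorem norm_ofShell {ε : ℝ} {y : E} (hy : y ∈ shell E ε) :
    ‖ofShell ε y‖ = (‖y‖ - 1) / (1 + ε - ‖y‖) := by
  have h1 : 0 < ‖y‖ - 1 := by linarith [hy.1]
  have h2 : 0 < 1 + ε - ‖y‖ := by linarith [hy.2]
  have h3 : 0 < ‖y‖ := by linarith
  rw [ofShell, norm_smul, Real.norm_of_nonneg (by positivity)]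
  field_simp

theorem ofShell_ne_zero {ε : ℝ} {y : E} (hy : y ∈ shell E ε) : ofShell ε y ≠ 0 := by
  have h1 : 0 < ‖y‖ - 1 := by linarith [hy.1]
  have h2 : 0 < 1 + ε - ‖y‖ := by linarith [hy.2]
  rw [← norm_pos_iff, norm_ofShell hy]
  positivity

theorem toShell_ofShell {ε : ℝ} (hε : 0 < ε) {y : E} (hy : y ∈ shell E ε) :
    toShell ε (ofShell ε y) = y := by
  have h1 : 0 < ‖y‖ - 1 := by linarith [hy.1]
  have h2 : 0 < 1 + ε - ‖y‖ := by linarith [hy.2]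
  have h3 : 0 < ‖y‖ := by linarith
  have h4 : 1 + (‖y‖ - 1) / (1 + ε - ‖y‖) = ε / (1 + ε - ‖y‖) := by
    field_simp
    ring
  rw [toShell, norm_ofShell hy, h4, ofShell, smul_smul]
  convert one_smul ℝ y
  field_simp
  ring

theorem contDiffAt_toShell {ε : ℝ} {x : E} (hx : x ≠ 0) {n : WithTop ℕ∞} :
    ContDiffAt ℝ n (toShell ε) x := by
  have h : 0 < ‖x‖ := norm_pos_iff.2 hx
  have hn : ContDiffAt ℝ n (fun z : E => ‖z‖) x := contDiffAt_norm ℝ hx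
  exact ((contDiffAt_const.div hn h.ne').add
    (contDiffAt_const.div (contDiffAt_const.add hn) (by positivity))).smul contDiffAt_id

theorem differentiableAt_ofShell {ε : ℝ} {y : E} (hy : y ∈ shell E ε) :
    DifferentiableAt ℝ (ofShell ε) y := by
  have h2 : 0 < 1 + ε - ‖y‖ := by linarith [hy.2]
  have h3 : 0 < ‖y‖ := by linarith [hy.1]
  have hn : DifferentiableAt ℝ (fun z : E => ‖z‖) y :=
    (contDiffAt_norm (n := 1) ℝ (norm_pos_iff.1 h3)).differentiableAt one_ne_zero
  have hne : (1 + ε - ‖y‖) * ‖y‖ ≠ 0 := (mul_pos h2 h3).ne'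
  unfold ofShell
  fun_prop (disch := assumption)

/-- A smooth closed one-form on a shell is exact in dimension at least three. -/
theorem exists_primitive_shell [FiniteDimensional ℝ E] (hdim : 2 < Module.finrank ℝ E) {ε : ℝ}
    (hε : 0 < ε) {τ : E → E [⋀^Fin 1]→L[ℝ] ℝ} (hτ : ∀ y ∈ shell E ε, ContDiffAt ℝ ∞ τ y)
    (hclosed : ∀ y ∈ shell E ε, extDeriv τ y = 0) :
    ∃ f : E → ℝ, ContDiffOn ℝ ∞ f (shell E ε) ∧
      ∀ y ∈ shell E ε, oneFormEquiv E (fderiv ℝ f y) = τ y := by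
  -- The form is transported to the punctured space, integrated there, and the primitive is carried
  -- back by `ofShell`.
  let σ : E → E [⋀^Fin 1]→L[ℝ] ℝ := fun x =>
    (τ (toShell ε x)).compContinuousLinearMap (fderiv ℝ (toShell ε) x)
  have hσ : ∀ x : E, x ≠ 0 → DifferentiableAt ℝ σ x := by
    intro x hx
    refine (contDiffAt_compContinuousLinearMap (n := 1) ?_ ?_).differentiableAt one_ne_zero
    · exact ((hτ _ (toShell_mem hε hx)).of_le (by exact_mod_cast le_top)).comp x
        (contDiffAt_toShell hx)
    · exact (contDiffAt_toShell (n := 2) hx).fderiv_right (by norm_num)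
  have hσc : ∀ x : E, x ≠ 0 → extDeriv σ x = 0 := by
    intro x hx
    rw [extDeriv_pullback (r := 2)
      ((hτ _ (toShell_mem hε hx)).differentiableAt (by simp)) (contDiffAt_toShell hx) (by simp),
      hclosed _ (toShell_mem hε hx)]
    rfl
  obtain ⟨f, hf⟩ := exists_primitive_compl_zero hdim
    (w := fun x => (oneFormEquiv E).symm (σ x))
    (fun x hx => (oneFormEquiv E).symm.differentiable.differentiableAt.comp x (hσ x hx))
    (fun x hx => fderiv_symm_of_extDeriv_eq_zero (hσ x hx) (hσc x hx))
  have hd : ∀ y ∈ shell E ε,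
      HasFDerivAt (fun z => f (ofShell ε z)) ((oneFormEquiv E).symm (τ y)) y := by
    intro y hy
    have h0 := ofShell_ne_zero hy
    have hc := (hf _ h0).comp y (differentiableAt_ofShell hy).hasFDerivAt
    have hid : (fderiv ℝ (toShell ε) (ofShell ε y)).comp (fderiv ℝ (ofShell ε) y) =
        ContinuousLinearMap.id ℝ E := by
      rw [← fderiv_comp y ((contDiffAt_toShell (n := 1) h0).differentiableAt one_ne_zero)
        (differentiableAt_ofShell hy)]
      have : toShell ε ∘ ofShell ε =ᶠ[𝓝 y] id := by
        filter_upwards [(isOpen_shell ε).mem_nhds hy] with z hz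
        exact toShell_ofShell hε hz
      rw [this.fderiv_eq, fderiv_id]
    rw [oneFormEquiv_symm_compContinuousLinearMap, ContinuousLinearMap.comp_assoc, hid,
      ContinuousLinearMap.comp_id, toShell_ofShell hε hy] at hc
    exact hc
  refine ⟨fun z => f (ofShell ε z), ?_, fun y hy => ?_⟩
  · rw [contDiffOn_infty_iff_fderiv_of_isOpen (isOpen_shell ε)]
    refine ⟨fun y hy => (hd y hy).differentiableAt.differentiableWithinAt, ?_⟩
    have : ContDiffOn ℝ ∞ (fun y => (oneFormEquiv E).symm (τ y)) (shell E ε) := fun y hy =>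
      ((oneFormEquiv E).symm.contDiff.contDiffAt.comp y (hτ y hy)).contDiffWithinAt
    exact this.congr fun y hy => (hd y hy).fderiv
  · rw [(hd y hy).fderiv, LinearIsometryEquiv.apply_symm_apply]

end Shell

/-! ### Naturality of pullback and exterior derivative -/

section Naturality

variable {m k : ℕ}
  {M : Type*} [TopologicalSpace M] [ChartedSpace (Model m) M]
  {N : Type*} [TopologicalSpace N] [ChartedSpace (Model m) N]
  {P : Type*} [TopologicalSpace P] [ChartedSpace (Model m) P]

/-- Smoothness of a form at a point. -/
def SmoothFormAt (τ : DiffForm m k M) (x : M) : Prop :=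
  ContDiffAt ℝ ∞ (inChart τ x) (extChartAt (modelI m) x x)

theorem inChart_eq_pullback (τ : DiffForm m k M) (x₀ : M) :
    inChart τ x₀ = pullback (extChartAt (modelI m) x₀).symm τ := rfl

theorem pullback_congr {f f' : N → M} {p : N} (h : f =ᶠ[𝓝 p] f') (τ : DiffForm m k M) :
    pullback f τ p = pullback f' τ p := by
  have h1 := h.mfderiv_eq (I := modelI m) (I' := modelI m)
  have h2 := h.self_of_nhds
  unfold pullback
  rw [h1, h2]

theorem pullback_comp {f : N → M} {h : P → N} {q : P}
    (hf : MDifferentiableAt (modelI m) (modelI m) f (h q))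
    (hh : MDifferentiableAt (modelI m) (modelI m) h q) (τ : DiffForm m k M) :
    pullback (f ∘ h) τ q = pullback h (pullback f τ) q := by
  unfold pullback
  rw [mfderiv_comp q hf hh]
  rfl

theorem pullback_id (τ : DiffForm m k M) (x : M) : pullback id τ x = τ x := by
  unfold pullback
  rw [mfderiv_id]
  ext v
  rfl

theorem inChart_congr {τ τ' : DiffForm m k M} {x : M} (h : ∀ᶠ y in 𝓝 x, τ y = τ' y) :
    inChart τ x =ᶠ[𝓝 (extChartAt (modelI m) x x)] inChart τ' x := by
  have hc : Filter.Tendsto (extChartAt (modelI m) x).symm (𝓝 (extChartAt (modelI m) x x))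
      (𝓝 x) := by
    simpa using (continuousAt_extChartAt_symm (I := modelI m) x).tendsto
  filter_upwards [hc.eventually h] with u hu
  unfold inChart
  rw [hu]

theorem SmoothFormAt.congr {τ τ' : DiffForm m k M} {x : M} (hτ : SmoothFormAt τ x)
    (h : ∀ᶠ y in 𝓝 x, τ' y = τ y) : SmoothFormAt τ' x :=
  ContDiffAt.congr_of_eventuallyEq hτ (inChart_congr h)

theorem extd_congr {τ τ' : DiffForm m k M} {x : M} (h : ∀ᶠ y in 𝓝 x, τ y = τ' y) :
    extd τ x = extd τ' x := by
  unfold extd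
  rw [(inChart_congr h).extDeriv_eq]

theorem SmoothFormOn.smoothFormAt {τ : DiffForm m k M} {U : Set M} (hτ : SmoothFormOn τ U)
    {x : M} (hx : U ∈ 𝓝 x) : SmoothFormAt τ x := by
  refine (hτ x).contDiffAt (Filter.inter_mem (extChartAt_target_mem_nhds x) ?_)
  refine (continuousAt_extChartAt_symm (I := modelI m) x).preimage_mem_nhds ?_
  simpa using hx

theorem inChart_model (τ : DiffForm m k (Model m)) (x₀ : Model m) : inChart τ x₀ = τ := by
  funext u
  have : ((extChartAt (modelI m) x₀).symm : Model m → Model m) = id := by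
    simp only [mfld_simps]
    rfl
  rw [inChart_eq_pullback, this, pullback_id]

theorem smoothFormAt_model {τ : DiffForm m k (Model m)} {u : Model m} :
    SmoothFormAt τ u ↔ ContDiffAt (E := Model m) (F := (Model m) [⋀^Fin k]→L[ℝ] ℝ) ℝ ∞ τ u := by
  unfold SmoothFormAt
  rw [inChart_model]
  simp only [mfld_simps, chartAt_self_eq]

theorem extd_model (τ : DiffForm m k (Model m)) (u : Model m) :
    extd τ u = extDeriv (E := Model m) (F := ℝ) τ u := by
  have h : ((extChartAt (modelI m) u) : Model m → Model m) = id := by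
    simp only [mfld_simps, chartAt_self_eq]
  unfold extd
  rw [inChart_model, h, mfderiv_id]
  ext v
  rfl

variable [IsManifold (modelI m) ∞ M]

/-- Expresses the pullback on a whole neighbourhood through the single chart at `x₀`, so that
calculus in the model space applies to it. -/
theorem eventually_pullback_eq {f : N → M} {p : N} {x₀ : M} (hx : f p = x₀)
    [IsManifold (modelI m) ∞ N]
    (hf : ContMDiffAt (modelI m) (modelI m) ∞ f p) (τ : DiffForm m k M) :
    ∀ᶠ q in 𝓝 p, pullback f τ q = pullback (extChartAt (modelI m) x₀ ∘ f) (inChart τ x₀) q := by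
  have : IsManifold (modelI m) 1 M := IsManifold.of_le (n := ∞) (by exact_mod_cast le_top)
  have : IsManifold (modelI m) 1 N := IsManifold.of_le (n := ∞) (by exact_mod_cast le_top)
  have h1 : ∀ᶠ q in 𝓝 p, ContMDiffAt (modelI m) (modelI m) 1 f q :=
    (contMDiffAt_iff_contMDiffAt_nhds (by simp)).1
      (ContMDiffAt.of_le (n := ∞) hf (by simp))
  have h2 : ∀ᶠ q in 𝓝 p, f q ∈ (chartAt (Model m) x₀).source := by
    refine hf.continuousAt.eventually_mem ?_
    rw [hx]
    exact chart_source_mem_nhds (Model m) x₀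
  filter_upwards [h1, h2.eventually_nhds] with q hq hqs
  have hs := hqs.self_of_nhds
  have hsx : f q ∈ (extChartAt (modelI m) x₀).source := by rwa [extChartAt_source]
  have hfd := hq.mdifferentiableAt one_ne_zero
  have hT : MDifferentiableAt (modelI m) (modelI m) (extChartAt (modelI m) x₀ ∘ f) q :=
    (mdifferentiableAt_extChartAt hs).comp q hfd
  have hS : MDifferentiableAt (modelI m) (modelI m) (extChartAt (modelI m) x₀).symm
      ((extChartAt (modelI m) x₀ ∘ f) q) :=
    ((contMDiffOn_extChartAt_symm (n := ∞) x₀).contMDiffAt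
      (extChartAt_target_mem_nhds' ((extChartAt (modelI m) x₀).map_source hsx))).mdifferentiableAt
      (by simp)
  rw [inChart_eq_pullback, ← pullback_comp hS hT]
  refine pullback_congr ?_ τ
  filter_upwards [hqs] with z hz
  exact ((extChartAt (modelI m) x₀).left_inv (by rwa [extChartAt_source])).symm

theorem pullback_model (T : Model m → Model m) (A : Model m → (Model m) [⋀^Fin k]→L[ℝ] ℝ)
    (u : Model m) :
    pullback T A u = (A (T u)).compContinuousLinearMap (fderiv ℝ T u) := by
  unfold pullback
  rw [mfderiv_eq_fderiv]
  rfl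

omit [IsManifold (modelI m) ∞ M] in
theorem contDiffAt_chart_comp {φ : Model m → M} {u : Model m} {x : M} (hx : φ u = x)
    (hφ : ContMDiffAt (modelI m) (modelI m) ∞ φ u) :
    ContDiffAt ℝ ∞ (extChartAt (modelI m) x ∘ φ) u := by
  subst hx
  exact contMDiffAt_iff_contDiffAt.1 (contMDiffAt_extChartAt.comp u hφ)

theorem contDiffAt_pullback {τ : DiffForm m 1 M} {φ : Model m → M} {u : Model m} {x : M}
    (hx : φ u = x) (hτ : SmoothFormAt τ x)
    (hφ : ContMDiffAt (modelI m) (modelI m) ∞ φ u) :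
    ContDiffAt (E := Model m) (F := (Model m) [⋀^Fin 1]→L[ℝ] ℝ) ℝ ∞ (pullback φ τ) u := by
  have hT := contDiffAt_chart_comp hx hφ
  subst hx
  refine ContDiffAt.congr_of_eventuallyEq (f := fun q =>
    (inChart τ (φ u) ((extChartAt (modelI m) (φ u) ∘ φ) q)).compContinuousLinearMap
      (fderiv ℝ (extChartAt (modelI m) (φ u) ∘ φ) q)) ?_ ?_
  · exact contDiffAt_compContinuousLinearMap (ContDiffAt.comp (g := inChart τ (φ u)) u hτ hT)
      (hT.fderiv_right (by simp))
  · filter_upwards [eventually_pullback_eq rfl hφ τ] with q hq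
    rw [hq, pullback_model]

/-- The chart at `φ u` is the one that defines `extd` there, so the claim reduces to naturality of
`extDeriv` under the coordinate expression of `φ`. -/
theorem extDeriv_pullback_eq {τ : DiffForm m k M} {φ : Model m → M} {u : Model m} {x : M}
    (hx : φ u = x) (hτ : SmoothFormAt τ x)
    (hφ : ContMDiffAt (modelI m) (modelI m) ∞ φ u) :
    extDeriv (E := Model m) (F := ℝ) (pullback φ τ) u = pullback φ (extd τ) u := by
  have hT := contDiffAt_chart_comp hx hφ
  subst hx
  have h : (pullback φ τ : Model m → (Model m) [⋀^Fin k]→L[ℝ] ℝ) =ᶠ[𝓝 u] fun q =>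
      (inChart τ (φ u) ((extChartAt (modelI m) (φ u) ∘ φ) q)).compContinuousLinearMap
        (fderiv ℝ (extChartAt (modelI m) (φ u) ∘ φ) q) := by
    filter_upwards [eventually_pullback_eq rfl hφ τ] with q hq
    rw [hq, pullback_model]
  have hτd : DifferentiableAt ℝ (inChart τ (φ u)) ((extChartAt (modelI m) (φ u) ∘ φ) u) :=
    ContDiffAt.differentiableAt hτ (by simp)
  have : IsManifold (modelI m) 1 M := IsManifold.of_le (n := ∞) (by exact_mod_cast le_top)
  rw [h.extDeriv_eq, extDeriv_pullback hτd hT minSmoothness_two_le_infty, ← mfderiv_eq_fderiv,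
    mfderiv_comp u (mdifferentiableAt_extChartAt (mem_chart_source _ _))
      (hφ.mdifferentiableAt (by simp))]
  rfl

variable [IsManifold (modelI m) ∞ N]

omit [IsManifold (modelI m) ∞ M] in
theorem contMDiffAt_comp_chart_symm {f : N → M} {p : N}
    (hf : ContMDiffAt (modelI m) (modelI m) ∞ f p) :
    ContMDiffAt (modelI m) (modelI m) ∞ (f ∘ (extChartAt (modelI m) p).symm)
      (extChartAt (modelI m) p p) := by
  refine ContMDiffAt.comp_of_eq hf ?_ (extChartAt_to_inv p)
  exact (contMDiffOn_extChartAt_symm p).contMDiffAt (extChartAt_target_mem_nhds p)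

theorem inChart_pullback {f : N → M} {p : N} (hf : ContMDiffAt (modelI m) (modelI m) ∞ f p)
    (τ : DiffForm m k M) :
    inChart (pullback f τ) p =ᶠ[𝓝 (extChartAt (modelI m) p p)]
      pullback (f ∘ (extChartAt (modelI m) p).symm) τ := by
  have : IsManifold (modelI m) 1 M := IsManifold.of_le (n := ∞) (by exact_mod_cast le_top)
  have : IsManifold (modelI m) 1 N := IsManifold.of_le (n := ∞) (by exact_mod_cast le_top)
  have h1 : ∀ᶠ q in 𝓝 p, ContMDiffAt (modelI m) (modelI m) 1 f q :=
    (contMDiffAt_iff_contMDiffAt_nhds (by simp)).1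
      (ContMDiffAt.of_le (n := ∞) hf (by simp))
  have hc : Filter.Tendsto (extChartAt (modelI m) p).symm (𝓝 (extChartAt (modelI m) p p))
      (𝓝 p) := by
    simpa using (continuousAt_extChartAt_symm (I := modelI m) p).tendsto
  filter_upwards [hc.eventually h1, extChartAt_target_mem_nhds p] with u hu ht
  rw [inChart_eq_pullback, pullback_comp (hu.mdifferentiableAt one_ne_zero)]
  exact ((contMDiffOn_extChartAt_symm (n := ∞) p).contMDiffAt
    (extChartAt_target_mem_nhds' ht)).mdifferentiableAt (by simp)

theorem smoothFormAt_pullback {f : N → M} {p : N}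
    (hf : ContMDiffAt (modelI m) (modelI m) ∞ f p) {τ : DiffForm m 1 M}
    (hτ : SmoothFormAt τ (f p)) : SmoothFormAt (pullback f τ) p :=
  (contDiffAt_pullback (congrArg f (extChartAt_to_inv p)) hτ
    (contMDiffAt_comp_chart_symm hf)).congr_of_eventuallyEq (inChart_pullback hf τ)

/-- The exterior derivative commutes with pullbacks. -/
theorem extd_pullback {f : N → M} {p : N}
    (hf : ContMDiffAt (modelI m) (modelI m) ∞ f p) {τ : DiffForm m k M}
    (hτ : SmoothFormAt τ (f p)) : extd (pullback f τ) p = pullback f (extd τ) p := by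
  have : IsManifold (modelI m) 1 N := IsManifold.of_le (n := ∞) (by exact_mod_cast le_top)
  -- Reading `f` in the chart at `p` gives a map from the model space, the case already treated;
  -- pulling back along the chart then undoes its inverse.
  have h1 : extd (pullback f τ) p = pullback (extChartAt (modelI m) p)
      (pullback (f ∘ (extChartAt (modelI m) p).symm) (extd τ)) p := by
    unfold extd
    rw [(inChart_pullback hf τ).extDeriv_eq,
      extDeriv_pullback_eq (congrArg f (extChartAt_to_inv p)) hτ (contMDiffAt_comp_chart_symm hf)]
    rfl
  rw [h1, ← pullback_comp ((contMDiffAt_comp_chart_symm hf).mdifferentiableAt (by simp))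
    (mdifferentiableAt_extChartAt (mem_chart_source _ _))]
  refine pullback_congr ?_ _
  filter_upwards [extChartAt_source_mem_nhds (I := modelI m) p] with q hq
  exact congrArg f ((extChartAt (modelI m) p).left_inv hq)

omit [IsManifold (modelI m) ∞ N] in
-- `SmoothFormAt` tests a point only in its own preferred chart, `SmoothFormOn` in every preferred
-- chart. Pulling back along the inverse chart bridges the two.
theorem smoothFormOn_univ {τ : DiffForm m 1 M} (h : ∀ x, SmoothFormAt τ x) :
    SmoothFormOn τ univ := fun x₀ _ hu =>
  (contDiffAt_pullback rfl (h _) ((contMDiffOn_extChartAt_symm x₀).contMDiffAt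
    (extChartAt_target_mem_nhds' hu.1))).contDiffWithinAt

omit [IsManifold (modelI m) ∞ M] [IsManifold (modelI m) ∞ N] in
/-- Pullback along a local diffeomorphism is injective. -/
theorem pullback_injective {f : N → M} {p : N}
    (hf : IsLocalDiffeomorphAt (modelI m) (modelI m) ∞ f p) {τ τ' : DiffForm m k M}
    (h : pullback f τ p = pullback f τ' p) : τ (f p) = τ' (f p) := by
  ext v
  let e := hf.mfderivToContinuousLinearEquiv (by simp)
  have h1 := DFunLike.congr_fun h (fun i => e.symm (v i))
  have h2 : (fun i => mfderiv (modelI m) (modelI m) f p (e.symm (v i))) = v := by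
    funext i
    exact e.apply_symm_apply (v i)
  change τ (f p) (fun i => mfderiv (modelI m) (modelI m) f p (e.symm (v i))) =
    τ' (f p) (fun i => mfderiv (modelI m) (modelI m) f p (e.symm (v i))) at h1
  rwa [h2] at h1

end Naturality

/-! ### Open embeddings and their inverses -/

section Transplant

variable {m : ℕ}
  {M : Type*} [TopologicalSpace M] [ChartedSpace (Model m) M]
  {N : Type*} [TopologicalSpace N] [ChartedSpace (Model m) N]

theorem IsOpenEmbeddingOn.isOpen_image {f : M → N} {s t : Set M} (hf : IsOpenEmbeddingOn (m := m) f s)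
    (ht : IsOpen t) (hts : t ⊆ s) : IsOpen (f '' t) := by
  rw [isOpen_iff_mem_nhds]
  rintro _ ⟨x, hx, rfl⟩
  have h := (IsLocalDiffeomorphOn.isLocalHomeomorphOn hf.localDiffeo).map_nhds_eq (hts hx)
  rw [← h]
  exact Filter.image_mem_map (ht.mem_nhds hx)

theorem IsOpenEmbeddingOn.contMDiffAt {f : M → N} {s : Set M} (hf : IsOpenEmbeddingOn (m := m) f s)
    {x : M} (hx : x ∈ s) : ContMDiffAt (modelI m) (modelI m) ∞ f x :=
  (hf.localDiffeo ⟨x, hx⟩).contMDiffAt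

/-- An inverse of an open embedding on its image is smooth. -/
theorem IsOpenEmbeddingOn.contMDiffAt_leftInverse {f : M → N} {s : Set M}
    (hf : IsOpenEmbeddingOn (m := m) f s) (hs : IsOpen s) {ψ : N → M} (hψ : ∀ u ∈ s, ψ (f u) = u) {x : M}
    (hx : x ∈ s) : ContMDiffAt (modelI m) (modelI m) ∞ ψ (f x) := by
  have hl := hf.localDiffeo ⟨x, hx⟩
  refine hl.localInverse_contMDiffAt.congr_of_eventuallyEq ?_
  -- Continuity of `ψ` is not assumed. Near `f x` the smooth local inverse stays in `s`, which
  -- forces `ψ` to coincide with it.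
  have hc : ∀ᶠ z in 𝓝 (f x), hl.localInverse z ∈ s := by
    refine hl.localInverse_contMDiffAt.continuousAt.eventually_mem ?_
    rw [hl.localInverse_left_inv hl.localInverse_mem_target]
    exact hs.mem_nhds hx
  filter_upwards [hc, hl.localInverse_eventuallyEq_right] with z hz hz'
  calc ψ z = ψ (f (hl.localInverse z)) := by rw [show f (hl.localInverse z) = z from hz']
    _ = hl.localInverse z := hψ _ hz

theorem IsOpenEmbeddingOn.continuousOn {f : M → N} {s : Set M} (hf : IsOpenEmbeddingOn (m := m) f s) :
    ContinuousOn f s := fun _ hx =>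
  (hf.contMDiffAt hx).continuousAt.continuousWithinAt

end Transplant

/-! ### Merging two primitives across a shell -/

section BallForms

variable {m : ℕ}

/-- In dimension at least three, two primitives of the same two-form, one on a ball and one on
a shell at its boundary, can be merged into a primitive on the ball that coincides with the second
one near the boundary. -/
theorem exists_merged_primitive (hm : 1 ≤ m) {ε : ℝ} (hε : 0 < ε)
    {b l : Model m → (Model m) [⋀^Fin 1]→L[ℝ] ℝ}
    (hb : ∀ u ∈ ball (0 : Model m) (1 + ε), ContDiffAt ℝ ∞ b u)
    (hl : ∀ u ∈ shell (Model m) ε, ContDiffAt ℝ ∞ l u)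
    (hbl : ∀ u ∈ shell (Model m) ε, extDeriv b u = extDeriv l u) :
    ∃ t : Model m → (Model m) [⋀^Fin 1]→L[ℝ] ℝ,
      (∀ u ∈ ball (0 : Model m) (1 + ε), ContDiffAt ℝ ∞ t u ∧ extDeriv t u = extDeriv b u) ∧
      ∀ u ∈ ball (0 : Model m) (1 + ε), 1 + ε / 2 < ‖u‖ → t u = l u := by
  have hsb : ∀ u ∈ shell (Model m) ε, u ∈ ball (0 : Model m) (1 + ε) := fun u hu => by
    simpa using hu.2
  obtain ⟨f, hf, hfd⟩ := exists_primitive_shell (E := Model m) (τ := l - b)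
    (by rw [finrank_euclideanSpace_fin]; omega) hε
    (fun y hy => (hl y hy).sub (hb y (hsb y hy)))
    (fun y hy => by
      have h1 : l - b = l + (-1 : ℝ) • b := by
        funext z
        change l z - b z = l z + (-1 : ℝ) • b z
        rw [sub_eq_add_neg]
        exact congrArg _ (neg_one_smul ℝ (b z)).symm
      have hd : DifferentiableAt ℝ ((-1 : ℝ) • b) y :=
        ((hb y (hsb y hy)).differentiableAt (by simp)).const_smul _
      rw [h1, extDeriv_add ((hl y hy).differentiableAt (by simp)) hd, extDeriv_smul, hbl y hy]
      simp)
  -- `F = (1 - χ) f` vanishes on the ball of radius `1 + ε / 4`, hence wherever `f` is uncontrolled,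
  -- and equals `f` beyond radius `1 + ε / 2`.
  let χ : ContDiffBump (0 : Model m) := ⟨1 + ε / 4, 1 + ε / 2, by positivity, by linarith⟩
  let F : Model m → ℝ := fun u => (1 - χ u) * f u
  have hF : ∀ u ∈ ball (0 : Model m) (1 + ε), ContDiffAt ℝ ∞ F u := by
    intro u hu
    by_cases h : ‖u‖ < 1 + ε / 4
    · have h0 : F =ᶠ[𝓝 u] fun _ => 0 := by
        filter_upwards [(isOpen_lt continuous_norm continuous_const).mem_nhds h] with z hz
        have : χ z = 1 := χ.one_of_mem_closedBall (by
          rw [mem_closedBall_zero_iff]; exact le_of_lt hz)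
        simp [F, this]
      exact contDiffAt_const.congr_of_eventuallyEq h0
    · have hus : u ∈ shell (Model m) ε := ⟨by linarith, by simpa using hu⟩
      exact (contDiffAt_const.sub χ.contDiffAt).mul
        (hf.contDiffAt ((isOpen_shell ε).mem_nhds hus))
  let dF : Model m → (Model m) [⋀^Fin 1]→L[ℝ] ℝ := fun u => oneFormEquiv (Model m) (fderiv ℝ F u)
  have hdF : ∀ u ∈ ball (0 : Model m) (1 + ε), ContDiffAt ℝ ∞ dF u := fun u hu =>
    (oneFormEquiv (Model m)).contDiff.contDiffAt.comp u ((hF u hu).fderiv_right (by simp))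
  have hddF : ∀ u ∈ ball (0 : Model m) (1 + ε), extDeriv dF u = 0 := by
    intro u hu
    -- Seen as the differential of a zero-form, `dF` is closed by `d ∘ d = 0`.
    have h1 : dF = extDeriv
        (fun x => ContinuousAlternatingMap.constOfIsEmpty ℝ (Model m) (Fin 0) (F x)) := by
      funext x
      rw [extDeriv_constOfIsEmpty]
      rfl
    rw [h1]
    refine extDeriv_extDeriv_apply (r := ∞) ?_ minSmoothness_two_le_infty
    exact (ContinuousAlternatingMap.constOfIsEmptyLIE ℝ (Model m) ℝ (Fin 0)).contDiff.contDiffAt.comp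
      u (hF u hu)
  refine ⟨b + dF, fun u hu => ⟨(hb u hu).add (hdF u hu), ?_⟩, fun u hu hu2 => ?_⟩
  · rw [extDeriv_add ((hb u hu).differentiableAt (by simp))
      ((hdF u hu).differentiableAt (by simp)), hddF u hu, add_zero]
  · have hus : u ∈ shell (Model m) ε := ⟨by linarith, by simpa using hu⟩
    have h1 : F =ᶠ[𝓝 u] f := by
      filter_upwards [(isOpen_lt continuous_const continuous_norm).mem_nhds hu2] with z hz
      have : χ z = 0 := χ.zero_of_le_dist (by rw [dist_zero_right]; exact le_of_lt hz)
      simp [F, this]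
    change b u + oneFormEquiv (Model m) (fderiv ℝ F u) = l u
    rw [h1.fderiv_eq, hfd u hus]
    simp

end BallForms

/-! ### Extending a primitive over the removed disc -/

section Sites

variable {m : ℕ}
  {M' : Type*} [TopologicalSpace M'] [ChartedSpace (Model m) M']
  {M : Type*} [TopologicalSpace M] [ChartedSpace (Model m) M]

/-- A contact form on an open set as in the definition of being somewhere contact is a primitive
of the odd-dimensional symplectic form. -/
theorem IsContactOver.extd_eq [IsManifold (modelI m) ∞ M'] [IsManifold (modelI m) ∞ M]
    {π : M' → M} {α : DiffForm m 1 M'} {Ω : DiffForm m 2 M} {g : RMetric m M}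
    (h : IsVirtuallyContact π α Ω g) {U : Set M} {β : DiffForm m 1 M}
    (hU : IsContactOver π α U β) {x : M} (hx : x ∈ U) : extd β x = Ω x := by
  obtain ⟨y, rfl⟩ := h.surjective x
  have hπ := (h.localDiffeo y).contMDiffAt
  -- The equality may be tested upstairs, where `π^* dβ = d(π^* β) = dα = π^* Ω`.
  refine pullback_injective (h.localDiffeo y) ?_
  rw [← extd_pullback hπ (hU.contact.smooth.smoothFormAt (hU.isOpen.mem_nhds hx)), h.primitive]
  refine extd_congr ?_
  filter_upwards [hπ.continuousAt.eventually_mem (hU.isOpen.mem_nhds hx)] with z hz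
  exact hU.pullback_eq z hz

theorem SurgerySite.isCompact_image [IsManifold (modelI m) ∞ M] {π : M' → M}
    {α : DiffForm m 1 M'} {ε : ℝ} (S : SurgerySite π α ε) {r : ℝ} (hr : r < 1 + ε) :
    IsCompact (S.disc '' closedBall 0 r) :=
  (isCompact_closedBall 0 r).image_of_continuousOn
    (S.disc_embedding.continuousOn.mono (closedBall_subset_ball hr))

/-- If `Ω` has a smooth primitive on the complement of the disc of a surgery site, then `Ω` is
exact. -/
theorem SurgerySite.isExact [T2Space M] [IsManifold (modelI m) ∞ M'] [IsManifold (modelI m) ∞ M]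
    (hm : 1 ≤ m) {π : M' → M} {α : DiffForm m 1 M'} {Ω : DiffForm m 2 M} {g : RMetric m M}
    (h : IsVirtuallyContact π α Ω g) {ε : ℝ} (hε : 0 < ε) (S : SurgerySite π α ε)
    {μ : DiffForm m 1 M} (hμ : ∀ x ∈ S.Dᶜ, SmoothFormAt μ x)
    (hdμ : ∀ x ∈ S.Dᶜ, extd μ x = Ω x) : IsExact Ω := by
  classical
  have hβs : ∀ x ∈ S.U, SmoothFormAt S.β x := fun x hx =>
    S.contactOver.contact.smooth.smoothFormAt (S.contactOver.isOpen.mem_nhds hx)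
  have hU : ∀ u ∈ ball (0 : Model m) (1 + ε), S.disc u ∈ S.U := fun u hu =>
    S.disc_subset (mem_image_of_mem _ hu)
  have hdc : ∀ u ∈ ball (0 : Model m) (1 + ε),
      ContMDiffAt (modelI m) (modelI m) ∞ S.disc u := fun u hu => S.disc_embedding.contMDiffAt hu
  have hsb : ∀ u ∈ shell (Model m) ε, u ∈ ball (0 : Model m) (1 + ε) := fun u hu => by
    simpa using hu.2
  have hsD : ∀ u ∈ ball (0 : Model m) (1 + ε), 1 < ‖u‖ → S.disc u ∈ S.Dᶜ := by
    rintro u hu hu1 ⟨v, hv, hvu⟩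
    have hvb : v ∈ ball (0 : Model m) (1 + ε) := closedBall_subset_ball (by linarith) hv
    rw [S.disc_embedding.injOn hvb hu hvu, mem_closedBall_zero_iff] at hv
    linarith
  obtain ⟨t, ht, htl⟩ := exists_merged_primitive hm hε
    (b := pullback S.disc S.β) (l := pullback S.disc μ)
    (fun u hu => contDiffAt_pullback rfl (hβs _ (hU u hu)) (hdc u hu))
    (fun u hu => contDiffAt_pullback rfl (hμ _ (hsD u (hsb u hu) hu.1)) (hdc u (hsb u hu)))
    (fun u hu => by
      rw [extDeriv_pullback_eq rfl (hβs _ (hU u (hsb u hu))) (hdc u (hsb u hu)),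
        extDeriv_pullback_eq rfl (hμ _ (hsD u (hsb u hu) hu.1)) (hdc u (hsb u hu))]
      unfold pullback
      rw [S.contactOver.extd_eq h (hU u (hsb u hu)), hdμ _ (hsD u (hsb u hu) hu.1)])
  let B := ball (0 : Model m) (1 + ε)
  let ψ : M → Model m := Function.invFunOn S.disc B
  have hψ : ∀ u ∈ B, ψ (S.disc u) = u := fun u hu => S.disc_embedding.injOn.leftInvOn_invFunOn hu
  have hψc : ∀ u ∈ B, ContMDiffAt (modelI m) (modelI m) ∞ ψ (S.disc u) := fun u hu =>
    S.disc_embedding.contMDiffAt_leftInverse isOpen_ball hψ hu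
  have hV : IsOpen (S.disc '' B) := S.disc_embedding.isOpen_image isOpen_ball subset_rfl
  have hψd : ∀ u ∈ B, ∀ (k : ℕ) (τ : DiffForm m k M),
      pullback ψ (pullback S.disc τ) (S.disc u) = τ (S.disc u) := by
    intro u hu k τ
    have hd : MDifferentiableAt (modelI m) (modelI m) S.disc (ψ (S.disc u)) := by
      rw [hψ u hu]
      exact (hdc u hu).mdifferentiableAt (by simp)
    have hid : S.disc ∘ ψ =ᶠ[𝓝 (S.disc u)] id := by
      filter_upwards [hV.mem_nhds (mem_image_of_mem _ hu)] with y hy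
      obtain ⟨v, hv, rfl⟩ := hy
      exact congrArg S.disc (hψ v hv)
    rw [← pullback_comp hd ((hψc u hu).mdifferentiableAt (by simp))]
    exact (pullback_congr hid τ).trans (pullback_id τ _)
  let τ : DiffForm m 1 (Model m) := t
  -- The merged form `t` is pushed to `M` by the inverse `ψ` of the disc embedding, whose values off
  -- the image of `B` play no role.
  let lam : DiffForm m 1 M := fun x => if x ∈ S.disc '' B then pullback ψ τ x else μ x
  have hin : ∀ x ∈ S.disc '' B, SmoothFormAt lam x ∧ extd lam x = Ω x := by
    rintro _ ⟨u, hu, rfl⟩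
    have hlam : ∀ᶠ y in 𝓝 (S.disc u), lam y = pullback ψ τ y := by
      filter_upwards [hV.mem_nhds (mem_image_of_mem _ hu)] with y hy
      exact if_pos hy
    have hτ : SmoothFormAt τ (ψ (S.disc u)) := by
      rw [hψ u hu, smoothFormAt_model]
      exact (ht u hu).1
    refine ⟨(smoothFormAt_pullback (hψc u hu) hτ).congr hlam, ?_⟩
    have hdτ : extd τ u = pullback S.disc Ω u := by
      rw [extd_model]
      refine ((ht u hu).2.trans (extDeriv_pullback_eq rfl (hβs _ (hU u hu)) (hdc u hu))).trans ?_
      unfold pullback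
      rw [S.contactOver.extd_eq h (hU u hu)]
    rw [extd_congr hlam, extd_pullback (hψc u hu) hτ, ← hψd u hu 2 Ω]
    unfold pullback
    rw [hψ u hu, hdτ]
    rfl
  have hout : ∀ x ∉ S.disc '' B, SmoothFormAt lam x ∧ extd lam x = Ω x := by
    intro x hx
    have hxD : x ∈ S.Dᶜ := fun hxD =>
      hx (image_mono (closedBall_subset_ball (by linarith)) hxD)
    have hxK : x ∉ S.disc '' closedBall 0 (1 + ε / 2) := fun hxK =>
      hx (image_mono (closedBall_subset_ball (by linarith)) hxK)
    -- Points on the frontier of the image of `B` are the delicate ones. The smaller closed disc is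
    -- compact, hence closed in the Hausdorff space `M`, and off it both branches of `lam` equal
    -- `μ`.
    have hK := (S.isCompact_image (r := 1 + ε / 2) (by linarith)).isClosed
    have hlam : ∀ᶠ y in 𝓝 x, lam y = μ y := by
      filter_upwards [hK.isOpen_compl.mem_nhds hxK] with y hy
      by_cases hyB : y ∈ S.disc '' B
      · obtain ⟨u, hu, rfl⟩ := hyB
        have hu2 : 1 + ε / 2 < ‖u‖ := by
          by_contra hcon
          exact hy (mem_image_of_mem _ (by simpa using hcon))
        have h1 : lam (S.disc u) = pullback ψ τ (S.disc u) := if_pos (mem_image_of_mem _ hu)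
        have h2 : pullback ψ τ (S.disc u) = pullback ψ (pullback S.disc μ) (S.disc u) := by
          unfold pullback
          rw [hψ u hu]
          exact congrArg
            (fun A : (Model m) [⋀^Fin 1]→L[ℝ] ℝ => A.compContinuousLinearMap _) (htl u hu hu2)
        rw [h1, h2, hψd u hu 1 μ]
      · exact if_neg hyB
    exact ⟨(hμ x hxD).congr hlam, by rw [extd_congr hlam, hdμ x hxD]⟩
  have hall : ∀ x, SmoothFormAt lam x ∧ extd lam x = Ω x := fun x => by
    by_cases hx : x ∈ S.disc '' B
    · exact hin x hx
    · exact hout x hx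
  exact ⟨lam, smoothFormOn_univ fun x => (hall x).1, funext fun x => (hall x).2⟩

end Sites

end VContact

/-! ### Non-exactness of the connected sum -/

theorem mainTheorem7 (m : ℕ) (hm : 1 ≤ m)
    {M₁' : Type*} [TopologicalSpace M₁'] [T2Space M₁'] [SecondCountableTopology M₁']
    [ChartedSpace (Model m) M₁'] [IsManifold (modelI m) ∞ M₁']
    {M₁ : Type*} [TopologicalSpace M₁] [T2Space M₁] [SecondCountableTopology M₁]
    [ChartedSpace (Model m) M₁] [IsManifold (modelI m) ∞ M₁]
    {M₂' : Type*} [TopologicalSpace M₂'] [T2Space M₂'] [SecondCountableTopology M₂']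
    [ChartedSpace (Model m) M₂'] [IsManifold (modelI m) ∞ M₂']
    {M₂ : Type*} [TopologicalSpace M₂] [T2Space M₂] [SecondCountableTopology M₂]
    [ChartedSpace (Model m) M₂] [IsManifold (modelI m) ∞ M₂]
    {M' : Type*} [TopologicalSpace M'] [T2Space M'] [SecondCountableTopology M']
    [ChartedSpace (Model m) M'] [IsManifold (modelI m) ∞ M']
    {M : Type*} [TopologicalSpace M] [T2Space M] [SecondCountableTopology M]
    [ChartedSpace (Model m) M] [IsManifold (modelI m) ∞ M]
    (π₁ : M₁' → M₁) (α₁ : DiffForm m 1 M₁') (Ω₁ : DiffForm m 2 M₁) (g₁ : RMetric m M₁)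
    (h₁ : IsVirtuallyContact π₁ α₁ Ω₁ g₁) (hs₁ : IsSomewhereContact π₁ α₁)
    (π₂ : M₂' → M₂) (α₂ : DiffForm m 1 M₂') (Ω₂ : DiffForm m 2 M₂) (g₂ : RMetric m M₂)
    (h₂ : IsVirtuallyContact π₂ α₂ Ω₂ g₂) (hs₂ : IsSomewhereContact π₂ α₂)
    (π : M' → M) (α : DiffForm m 1 M') (Ω : DiffForm m 2 M) (g : RMetric m M)
    (S : CoveringContactConnectedSum π₁ α₁ Ω₁ g₁ π₂ α₂ Ω₂ g₂ π α Ω g)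
    (hΩ₁ : ¬ IsExact Ω₁) :
    ¬ IsExact Ω := by
  rintro ⟨lam, hlam, hdlam⟩
  apply hΩ₁
  have hD : IsOpen S.site₁.Dᶜ :=
    (S.site₁.isCompact_image (r := 1) (by linarith [S.ε_pos])).isClosed.isOpen_compl
  have hι : ∀ x ∈ S.site₁.Dᶜ, ContMDiffAt (modelI m) (modelI m) ∞ S.ι₁ x := fun x hx =>
    S.ι₁_embedding.contMDiffAt hx
  have hlam' : ∀ y, SmoothFormAt lam y := fun y => hlam.smoothFormAt Filter.univ_mem
  refine S.site₁.isExact hm h₁ S.ε_pos (μ := pullback S.ι₁ lam)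
    (fun x hx => smoothFormAt_pullback (hι x hx) (hlam' _)) fun x hx => ?_
  rw [extd_pullback (hι x hx) (hlam' _), hdlam]
  -- On `U₁ \ D₁` the forms are compared through `dγ` and `dβ`, using that `ι₁^* γ = β` on this open
  -- set; off `U₁` they agree by construction.
  by_cases hxU : x ∈ S.site₁.U
  · have hUD : IsOpen (S.site₁.U \ S.site₁.D) := S.site₁.contactOver.isOpen.inter hD
    have hsub : S.ι₁ '' (S.site₁.U \ S.site₁.D) ⊆ S.UU := by
      rw [S.UU_eq]
      exact subset_union_left.trans subset_union_left
    have hmem : S.ι₁ x ∈ S.ι₁ '' (S.site₁.U \ S.site₁.D) := mem_image_of_mem _ ⟨hxU, hx⟩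
    have hγ : SmoothFormAt S.γ (S.ι₁ x) := S.γ_contact.smooth.smoothFormAt
      (Filter.mem_of_superset
        ((S.ι₁_embedding.isOpen_image hUD fun y hy => hy.2).mem_nhds hmem) hsub)
    calc pullback S.ι₁ Ω x = pullback S.ι₁ (extd S.γ) x := by
          unfold pullback
          rw [S.Ω_eq _ (hsub hmem)]
      _ = extd (pullback S.ι₁ S.γ) x := (extd_pullback (hι x hx) hγ).symm
      _ = extd S.site₁.β x := extd_congr (by
          filter_upwards [hUD.mem_nhds ⟨hxU, hx⟩] with y hy
          exact S.γ_eq₁ y hy)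
      _ = Ω₁ x := S.site₁.contactOver.extd_eq h₁ hxU
  · exact S.Ω_eq₁ x hxU
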